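/- Let $\mathbb K$ be an algebraically closed field, $W$ a two-dimensional $\mathbb K$-vector space, and $\sharp: W\to W^\vee$, $v\mapsto v^\sharp$, a linear isomorphism with $v^\sharp(v)=0$ for all $v$. Let $k\ge 2$ and let $G$ be a $k$-uniform hypergraph with vertices $1,\dots,n$ and a family of $m$ edges (repetitions allowed). A *transfer filtration of type $b$* of $G$ is an ordering $E_1,\dots,E_m$ of the edges with a chain of subhypergraphs $G_0\subseteq G_1\subseteq\dots\subseteq G_m=G$ such that $E(G_i)=\{E_1,\dots,E_i\}$, $|V(G_i)|\le|V(G_{i-1})|+1$, a new vertex of $G_i$ lies in $E_i$, $|V(G_0)|=b$, and each edge has a vertex outside the foundation $V(G_0)$. Number the vertices so that $V(G_0)=\{1,\dots,b\}$. For $1\le i\le m$ let $r(i)$ be the smallest index with $|E_i\setminus V(G_{r(i)})|=1$ (it exists and $r(i)<i$). Define $p:\{1,\dots,b+m\}\to\{1,\dots,n\}$ by $p(j)=j$ for $j\le b$ and $\{p(b+i)\}=E_i\setminus V(G_{r(i)})$; it is surjective. For a vertex $u$ of $G$ put $\underline u=\min p^{-1}(u)$. A $k$-local constraint $H$ on $G$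 is a family of non-zero functionals $H_i^*:W^{\otimes E_i}\to\mathbb K$, and $\mathcal S_H$ is the set of $(v_1,\dots,v_n)\in W^n$ with all $v_u\ne0$ and $H_i^*(\bigotimes_{u\in E_i}v_u)=0$ for all $i$. The transfer functions $g_1,\dots,g_{b+m}:W^b\to W$ are defined recursively by $g_j(v)=v_j$ for $j\le b$ and $$\big(g_{b+i}(v)\big)^\sharp(x)=H_i^*\Big(x\otimes\bigotimes_{u\in E_i,\,u\neq p(b+i)}g_{\underline u}(v)\Big)\qquad(x\in W),$$ where $x$ is in the tensor factor of the vertex $p(b+i)$. The qualifiers are the functions $h(v)=(g_j(v))^\sharp\big(g_{\underline{p(j)}}(v)\big)$, one for each $j$ with $\underline{p(j)}<j$, and $\pi:W^n\to W^b$ is the restriction to the foundation. **Theorem.** Suppose $b=n-m+1$. There is a non-empty Zariski-open subset $U$ of $\prod_{i=1}^m\mathbb P\big((W^{\otimes E_i})^\vee\big)\cong(\mathbb P^{2^k-1}(\mathbb K))^m$ such that, for every $k$-local constraint $H$ on $G$ whose class lies in $U$ and every transfer filtration of type $b$ of $G$, there is exactly one qualifier $h_1:W^b\to\mathbb K$,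 and 1. $(h_1\circ\pi)^{-1}(0)\cap\mathcal S_H\ne\emptyset$; 2. every zero $\hat v=(\hat v_1,\dots,\hat v_b)$ of $h_1$ with all $\hat v_u\neq0$ is the image under $\pi$ of a point of $\mathcal S_H$; 3. for all non-zero $w_1,\dots,w_b\in W$, all $j\le b$ and all $w'\in W$ linearly independent of $w_j$, the function $t\mapsto h_1(w_1,\dots,w_j+tw',\dots,w_b)$ is a polynomial in $t\in\mathbb K$, and for each of its roots the point $(w_1,\dots,w_j+tw',\dots,w_b)$ is the image under $\pi$ of a point of $\mathcal S_H$; 4. for some such $w_1,\dots,w_b$, $j$ and $w'$ this polynomial is not constant, so that finding one root of one univariate polynomial gives a product solution. -/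

import Mathlib

open scoped TensorProduct LinearAlgebra.Projectivization Polynomial

noncomputable section

namespace QSAT

/-- A hypergraph with vertex set `Fin n` and a family of `m` edges (repeated edges are allowed). -/
structure Hypergraph (n m : ℕ) where
  edge : Fin m → Finset (Fin n)

/-- `G` is `k`-uniform: all its edges have size `k`. -/
def Hypergraph.IsUniform {n m : ℕ} (G : Hypergraph n m) (k : ℕ) : Prop :=
  ∀ i, (G.edge i).card = k

/-- A transfer filtration of type `b` of `G`: an ordering `E₁, …, E_m` of the edges and a chain of
subhypergraphs `G₀ ⊆ ⋯ ⊆ G_m = G`, where `G_i` has the vertices `vert i` and the edges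
`E₁, …, E_i`. With indices starting at `0`, the edge added between `vert i.castSucc` and
`vert i.succ` is `G.edge (order i)`. -/
structure TransferFiltration {n m : ℕ} (G : Hypergraph n m) (b : ℕ) where
  order : Equiv.Perm (Fin m)
  vert : Fin (m + 1) → Finset (Fin n)
  vert_mono : ∀ i : Fin m, vert i.castSucc ⊆ vert i.succ
  vert_last : vert (Fin.last m) = Finset.univ
  edge_subset : ∀ i : Fin m, G.edge (order i) ⊆ vert i.succ
  card_le : ∀ i : Fin m, (vert i.succ).card ≤ (vert i.castSucc).card + 1
  new_subset : ∀ i : Fin m, (vert i.succ).card = (vert i.castSucc).card + 1 →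
    vert i.succ \ vert i.castSucc ⊆ G.edge (order i)
  card_foundation : (vert 0).card = b
  edge_not_subset : ∀ i : Fin m, ∃ u ∈ G.edge i, u ∉ vert 0

namespace TransferFiltration

variable {n m b : ℕ} {G : Hypergraph n m} (F : TransferFiltration G b)

/-- The `i`-th edge in the order of the filtration. -/
abbrev E (i : Fin m) : Finset (Fin n) := G.edge (F.order i)

/-- The foundation `V(G₀)`. -/
abbrev Foundation : Type := {u : Fin n // u ∈ F.vert 0}

theorem new_card_le (i : Fin m) : (F.vert i.succ \ F.vert i.castSucc).card ≤ 1 := by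
  have h1 := F.card_le i
  have h2 := Finset.card_sdiff_add_card_eq_card (F.vert_mono i)
  omega

theorem exists_card_eq_one_aux (i : Fin m) (j : ℕ) (hj : j < m + 1)
    (h : (F.E i \ F.vert ⟨j, hj⟩).card ≤ 1) :
    ∃ l : Fin (m + 1), (l : ℕ) ≤ j ∧ (F.E i \ F.vert l).card = 1 := by
  induction j with
  | zero =>
    refine ⟨⟨0, hj⟩, le_rfl, le_antisymm h ?_⟩
    obtain ⟨u, hu, hu'⟩ := F.edge_not_subset (F.order i)
    exact Finset.card_pos.mpr ⟨u, Finset.mem_sdiff.mpr ⟨hu, hu'⟩⟩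
  | succ j ih =>
    by_cases h1 : (F.E i \ F.vert ⟨j + 1, hj⟩).card = 1
    · exact ⟨_, le_rfl, h1⟩
    · have h0 : F.E i \ F.vert ⟨j + 1, hj⟩ = ∅ := by
        rw [← Finset.card_eq_zero]; omega
      obtain ⟨l, hl, hl'⟩ := ih (by omega) (by
        refine le_trans (Finset.card_le_card ?_) (F.new_card_le ⟨j, by omega⟩)
        intro u hu
        rw [Finset.mem_sdiff] at hu ⊢
        refine ⟨?_, hu.2⟩
        exact Finset.sdiff_eq_empty_iff_subset.mp h0 hu.1)
      exact ⟨l, by omega, hl'⟩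

theorem edge_sdiff_card_le (i : Fin m) : (F.E i \ F.vert i.castSucc).card ≤ 1 :=
  le_trans (Finset.card_le_card (Finset.sdiff_subset_sdiff (F.edge_subset i) le_rfl))
    (F.new_card_le i)

/-- The stages `j` such that `E_i` has exactly one vertex outside `V(G_j)`. -/
def stages (i : Fin m) : Finset (Fin (m + 1)) :=
  Finset.univ.filter fun j => (F.E i \ F.vert j).card = 1

theorem exists_mem_stages (i : Fin m) : ∃ l ∈ F.stages i, l ≤ i.castSucc := by
  obtain ⟨l, hl, hl'⟩ := F.exists_card_eq_one_aux i i.val (by omega) (F.edge_sdiff_card_le i)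
  exact ⟨l, by simpa [stages] using hl', hl⟩

/-- `r i` is the smallest `j` such that `E_i` has exactly one vertex outside `V(G_j)`. -/
def r (i : Fin m) : Fin (m + 1) :=
  (F.stages i).min' ((F.exists_mem_stages i).imp fun _ h => h.1)

theorem r_le (i : Fin m) : F.r i ≤ i.castSucc := by
  obtain ⟨l, hl, hl'⟩ := F.exists_mem_stages i
  exact le_trans (Finset.min'_le _ _ hl) hl'

theorem card_sdiff_r (i : Fin m) : (F.E i \ F.vert (F.r i)).card = 1 := by
  have := Finset.min'_mem (F.stages i) ((F.exists_mem_stages i).imp fun _ h => h.1)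
  exact (Finset.mem_filter.mp this).2

/-- The unique vertex of `E_i` outside `V(G_{r(i)})`. -/
def pivot (i : Fin m) : Fin n := (Finset.card_eq_one.mp (F.card_sdiff_r i)).choose

theorem sdiff_r (i : Fin m) : F.E i \ F.vert (F.r i) = {F.pivot i} :=
  (Finset.card_eq_one.mp (F.card_sdiff_r i)).choose_spec

theorem pivot_mem (i : Fin m) : F.pivot i ∈ F.E i := by
  have : F.pivot i ∈ F.E i \ F.vert (F.r i) := by rw [F.sdiff_r]; simp
  exact (Finset.mem_sdiff.mp this).1

theorem vert_monotone : Monotone F.vert := Fin.monotone_iff_le_succ.mpr F.vert_mono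

/-- The vertices of the decoupled hypergraph: the foundation and one new vertex per edge. -/
abbrev DVertex : Type := F.Foundation ⊕ Fin m

/-- The map `p` from the vertices of the decoupled hypergraph to the vertices of `G`. -/
def p : F.DVertex → Fin n
  | Sum.inl u => u
  | Sum.inr i => F.pivot i

theorem exists_pivot_eq (u : Fin n) (hu : u ∉ F.vert 0) : ∃ i, F.pivot i = u := by
  by_contra hcon
  push Not at hcon
  have key : ∀ j : Fin (m + 1), u ∉ F.vert j := by
    intro j
    induction j using Fin.induction with
    | zero => exact hu
    | succ i ih =>
      intro hmem
      have hnew : u ∈ F.vert i.succ \ F.vert i.castSucc := Finset.mem_sdiff.mpr ⟨hmem, ih⟩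
      have h2 := Finset.card_sdiff_add_card_eq_card (F.vert_mono i)
      have h3 := F.new_card_le i
      have h4 := Finset.card_pos.mpr ⟨u, hnew⟩
      have hE : u ∈ F.E i := F.new_subset i (by omega) hnew
      have : u ∈ F.E i \ F.vert (F.r i) :=
        Finset.mem_sdiff.mpr ⟨hE, fun h => ih (F.vert_monotone (F.r_le i) h)⟩
      rw [F.sdiff_r, Finset.mem_singleton] at this
      exact hcon i this.symm
  exact key (Fin.last m) (by rw [F.vert_last]; exact Finset.mem_univ u)

/-- The least element of `p⁻¹(u)`, where the foundation comes before the other vertices of the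
decoupled hypergraph. -/
def first (u : Fin n) : F.DVertex :=
  if h : u ∈ F.vert 0 then Sum.inl ⟨u, h⟩
  else Sum.inr ((Finset.univ.filter fun i => F.pivot i = u).min' (by
    obtain ⟨i, hi⟩ := F.exists_pivot_eq u h
    exact ⟨i, by simpa using hi⟩))

/-- The vertex over `u ∈ E_i` in the `i`-th edge of the decoupled hypergraph: this edge consists of
the `i`-th new vertex, which lies over `pivot i`, and of the least vertices over the other vertices
of `E_i`. -/
def lift (i : Fin m) (u : Fin n) : F.DVertex :=
  if u = F.pivot i then Sum.inr i else F.first u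

/-- The `i`-th new vertex of the decoupled hypergraph is not the least vertex of its fibre under
`p`; these are the indices of the qualifiers. -/
def IsQualifierIndex (i : Fin m) : Prop := F.first (F.p (Sum.inr i)) ≠ Sum.inr i

/-- The map `Δ`, which gives all copies of a vertex of `G` the vector of that vertex. -/
def blowUp {W : Type*} (v : Fin n → W) : F.DVertex → W := fun j => v (F.p j)

/-- The map `π : Wⁿ → W^b`: `Δ` followed by the projection to the foundation. -/
def proj {W : Type*} (v : Fin n → W) : F.Foundation → W := fun u => F.blowUp v (Sum.inl u)

end TransferFiltration

section Constraints

variable {K W : Type*} [Field K] [AddCommGroup W] [Module K W] {n m b : ℕ}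

/-- A functional `H_i^*` on `W^{⊗ E_i}` for each edge `E_i` of `G`. -/
abbrev Constraint (K W : Type*) [Field K] [AddCommGroup W] [Module K W] (G : Hypergraph n m) :=
  ∀ i : Fin m, Module.Dual K (⨂[K] _ : {u // u ∈ G.edge i}, W)

/-- The local function `H_i(v₁, …, v_n) = H_i^*(⨂_{u ∈ E_i} v_u)`. -/
def localFun {G : Hypergraph n m} (H : Constraint K W G) (i : Fin m) (v : Fin n → W) : K :=
  H i (PiTensorProduct.tprod K fun u : {u // u ∈ G.edge i} => v u)

/-- The product satisfiability set `𝒮_H`. -/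
def productSat {G : Hypergraph n m} (H : Constraint K W G) : Set (Fin n → W) :=
  {v | (∀ u, v u ≠ 0) ∧ ∀ i, localFun H i v = 0}

namespace TransferFiltration

variable {G : Hypergraph n m} (F : TransferFiltration G b)

/-- The functional `x ↦ H_i^*(⋯ ⊗ x ⊗ ⋯)`, with `x` in the slot of the `i`-th new vertex of the
decoupled hypergraph and the vectors `a` in the slots of the other vertices of its `i`-th edge. -/
def sharpFun (H : Constraint K W G) (i : Fin m) (a : F.DVertex → W) : Module.Dual K W :=
  ((H (F.order i)).compMultilinearMap (PiTensorProduct.tprod K)).toLinearMap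
    (fun u => a (F.lift i u)) ⟨F.pivot i, F.pivot_mem i⟩

/-- The transfer functions of the first `t` new vertices of the decoupled hypergraph; the other new
vertices still have the value `0`. -/
def transferStage (sharp : W ≃ₗ[K] Module.Dual K W) (H : Constraint K W G)
    (v : F.Foundation → W) : ℕ → F.DVertex → W
  | 0 => Sum.elim v 0
  | t + 1 =>
    if h : t < m then
      Function.update (transferStage sharp H v t) (Sum.inr ⟨t, h⟩)
        (sharp.symm (F.sharpFun H ⟨t, h⟩ (transferStage sharp H v t)))
    else transferStage sharp H v t

/-- The transfer functions `g_j : W^b → W`: `g_j(v) = v_j` if `j` is in the foundation, and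
`(g_j(v))^♯ = H_i^*(⋯ ⊗ g_l(v) ⊗ ⋯ ⊗ (·))` if `j` is the `i`-th new vertex, with `l` running
through the other vertices of the `i`-th edge of the decoupled hypergraph. -/
def transfer (sharp : W ≃ₗ[K] Module.Dual K W) (H : Constraint K W G) (j : F.DVertex)
    (v : F.Foundation → W) : W :=
  F.transferStage sharp H v m j

/-- The qualifier `h(v) = (g_j(v))^♯ (g_{j'}(v))`, where `j` is the `s`-th new vertex of the
decoupled hypergraph and `j'` is the least vertex with `p(j') = p(j)`. -/
def qualifier (sharp : W ≃ₗ[K] Module.Dual K W) (H : Constraint K W G) (s : Fin m)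
    (v : F.Foundation → W) : K :=
  sharp (F.transfer sharp H (Sum.inr s) v)
    (F.transfer sharp H (F.first (F.p (Sum.inr s))) v)

end TransferFiltration

end Constraints

section Zariski

variable {K : Type*} [Field K]

/-- Polynomial functions on a vector space: the algebra generated by the linear functionals. -/
def IsPolynomialFun {X : Type*} [AddCommGroup X] [Module K X] (f : X → K) : Prop :=
  f ∈ Algebra.adjoin K (Set.range fun φ : Module.Dual K X => (φ : X → K))

variable {ι : Type*} [Fintype ι] {X : ι → Type*} [∀ i, AddCommGroup (X i)] [∀ i, Module K (X i)]

/-- `f` is homogeneous of multidegree `d`. -/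
def HasMultidegree (f : (∀ i, X i) → K) (d : ι → ℕ) : Prop :=
  ∀ (c : ι → K) (x : ∀ i, X i), f (fun i => c i • x i) = (∏ i, c i ^ d i) * f x

/-- Zariski open subsets of a product of projective spaces: the complement is the common zero locus
of a set of multihomogeneous polynomials. -/
def IsZariskiOpen (U : Set (∀ i, ℙ K (X i))) : Prop :=
  ∃ S : Set ((∀ i, X i) → K), (∀ f ∈ S, IsPolynomialFun f ∧ ∃ d, HasMultidegree f d) ∧
    Uᶜ = {x | ∀ f ∈ S, f (fun i => (x i).rep) = 0}

end Zariski

end QSAT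

end

/-!
The decoupled hypergraph has `b + m = n + 1` vertices, and `first` embeds the `n` vertices of `G` in
it, so exactly one new vertex `s` is left over: there is one qualifier.

*Every* zero of the qualifier with nonzero entries extends to a product solution, for *every*
constraint (`exists_mem_productSat_of_qualifier_eq_zero`). If no transfer value vanishes, these
values are the solution. If the recursion hits the value `0` at a new vertex `t ≠ s`, the functional
`x ↦ H_t(⋯ ⊗ x ⊗ ⋯)` vanishes, so the vector of this vertex may be chosen freely. The outcome of the
remaining recursion, compared at `s`, is a homogeneous polynomial in that vector which vanishes at
`0`. As `W` is a plane and `K` is algebraically closed, it has a nontrivial zero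
(`exists_ne_zero_eq_zero_of_homogeneous`), from which the recursion goes on.

Genericity is only needed to make the qualifier a nonconstant function. The open set `U` consists of
the constraints for which the qualifiers of all (finitely many) filtrations are nonzero at the
constant point `e`, a multihomogeneous polynomial condition on the constraint. It is non-empty
because decomposable functionals can give the transfer functions any nonzero values at that point
(`exists_qualifier_ne_zero`) and because finitely many nonzero polynomial functions have a common
nonzero (`exists_forall_ne_zero_of_isPolynomialFun`). The qualifier is multihomogeneous in the
foundation and vanishes at the origin, hence has positive degree in some argument, where it then has
a nontrivial zero. The line from `e` to this zero is one on which it is not constant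
(`exists_line`), and the zero extends to a product solution.
-/

namespace QSAT

/-! ### Vertices of the decoupled hypergraph -/

namespace TransferFiltration

variable {n m b : ℕ} {G : Hypergraph n m} (F : TransferFiltration G b)

instance : Finite (TransferFiltration G b) :=
  Finite.of_injective (fun F : TransferFiltration G b => (F.order, F.vert)) fun F F' h => by
    cases F
    cases F'
    simpa using h

@[simp]
theorem p_first (u : Fin n) : F.p (F.first u) = u := by
  unfold first
  split_ifs with h
  · rfl
  · exact (Finset.mem_filter.mp (Finset.min'_mem (Finset.univ.filter fun i => F.pivot i = u) _)).2

theorem first_injective : Function.Injective F.first :=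
  Function.LeftInverse.injective F.p_first

@[simp]
theorem first_p_inl (u : F.Foundation) : F.first (F.p (Sum.inl u)) = Sum.inl u := by
  obtain ⟨u, hu⟩ := u
  simp [first, p, hu]

/-- The double count behind the uniqueness of the qualifier: `first` embeds the `n` vertices of `G`
into the `b + m = n + 1` vertices of the decoupled hypergraph. -/
theorem exists_unique_isQualifierIndex (hb : b + m = n + 1) :
    ∃ s : Fin m, ∀ i, F.IsQualifierIndex i ↔ i = s := by
  classical
  have hcard : (Finset.univ.image F.first)ᶜ.card = 1 := by
    rw [Finset.card_compl, Finset.card_image_of_injective _ F.first_injective]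
    have : Fintype.card F.Foundation = b := by
      rw [Fintype.card_coe, F.card_foundation]
    simp only [DVertex, Fintype.card_sum, Fintype.card_fin, Finset.card_univ, this]
    omega
  obtain ⟨z, hz⟩ := Finset.card_eq_one.mp hcard
  have key : ∀ j, F.first (F.p j) ≠ j ↔ j = z := by
    intro j
    rw [← Finset.mem_singleton, ← hz]
    simp only [Finset.mem_compl, Finset.mem_image, Finset.mem_univ, true_and, not_exists]
    refine ⟨fun h u hu => h ?_, fun h => h _⟩
    rw [← hu, p_first]
  rcases z with u | s
  · exact absurd (F.first_p_inl u) ((key _).mpr rfl)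
  · exact ⟨s, fun i => (key _).trans (by simp)⟩

/-- A vertex of the decoupled hypergraph that precedes the `t`-th new vertex. -/
def Before (t : ℕ) (j : F.DVertex) : Prop := ∀ i : Fin m, j = Sum.inr i → (i : ℕ) < t

theorem before_first_of_mem_vert {u : Fin n} (l : Fin (m + 1)) (hu : u ∈ F.vert l) :
    F.Before l (F.first u) := by
  have key : ∀ l : Fin (m + 1), u ∈ F.vert l → u ∉ F.vert 0 →
      ∃ i : Fin m, (i : ℕ) < l ∧ F.pivot i = u := by
    intro l
    induction l using Fin.induction with
    | zero => exact fun h h' => absurd h h'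
    | succ i ih =>
      intro hmem h0
      by_cases hi : u ∈ F.vert i.castSucc
      · obtain ⟨i', h, h'⟩ := ih hi h0
        exact ⟨i', by simp at h ⊢; omega, h'⟩
      · have hnew : u ∈ F.vert i.succ \ F.vert i.castSucc := Finset.mem_sdiff.mpr ⟨hmem, hi⟩
        have h2 := Finset.card_sdiff_add_card_eq_card (F.vert_mono i)
        have h3 := F.new_card_le i
        have h4 := Finset.card_pos.mpr ⟨u, hnew⟩
        have hE : u ∈ F.E i := F.new_subset i (by omega) hnew
        have : u ∈ F.E i \ F.vert (F.r i) :=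
          Finset.mem_sdiff.mpr ⟨hE, fun h => hi (F.vert_monotone (F.r_le i) h)⟩
        rw [F.sdiff_r, Finset.mem_singleton] at this
        exact ⟨i, by simp, this.symm⟩
  intro i hi
  unfold first at hi
  split_ifs at hi with h0
  obtain ⟨i', h, h'⟩ := key l hu h0
  refine lt_of_le_of_lt (Fin.le_def.mp ?_) h
  rw [← Sum.inr.inj hi]
  exact Finset.min'_le _ _ (by simpa using h')

/-- The recursion for the transfer functions is well-founded: the other vertices of the `i`-th
decoupled edge come before the `i`-th new vertex. -/
theorem before_first_of_mem_edge {i : Fin m} {u : Fin n} (hu : u ∈ F.E i) (hp : u ≠ F.pivot i) :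
    F.Before i (F.first u) := by
  have h : u ∈ F.vert (F.r i) := by
    by_contra h
    have : u ∈ F.E i \ F.vert (F.r i) := Finset.mem_sdiff.mpr ⟨hu, h⟩
    rw [F.sdiff_r, Finset.mem_singleton] at this
    exact hp this
  intro j hj
  exact lt_of_lt_of_le (F.before_first_of_mem_vert _ h j hj) (Fin.le_def.mp (F.r_le i))

end TransferFiltration

/-! ### The recursion for the transfer functions, started at an arbitrary stage -/

section Run

variable {K W : Type*} [Field K] [AddCommGroup W] [Module K W] {n m b : ℕ}
  {G : Hypergraph n m}

namespace TransferFiltration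

variable (F : TransferFiltration G b) (sharp : W ≃ₗ[K] Module.Dual K W) (H : Constraint K W G)

/-- `sharpFun` refers to the least vertices over the vertices `≠ pivot i` of `E_i` only. -/
theorem sharpFun_apply (i : Fin m) (a : F.DVertex → W) (x : W) :
    F.sharpFun H i a x = H (F.order i) (PiTensorProduct.tprod K
      fun u : {u // u ∈ F.E i} => if (u : Fin n) = F.pivot i then x else a (F.first u)) := by
  simp only [sharpFun, MultilinearMap.toLinearMap_apply, LinearMap.compMultilinearMap_apply]
  congr 2
  ext u
  by_cases hu : (u : Fin n) = F.pivot i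
  · obtain rfl : u = ⟨F.pivot i, F.pivot_mem i⟩ := Subtype.ext hu
    simp
  · rw [Function.update_of_ne (fun h => hu (congrArg Subtype.val h))]
    simp [lift, hu]

theorem sharpFun_congr {i : Fin m} {a a' : F.DVertex → W}
    (h : ∀ j, F.Before i j → a j = a' j) : F.sharpFun H i a = F.sharpFun H i a' := by
  ext x
  rw [sharpFun_apply, sharpFun_apply]
  congr 2
  ext u
  split_ifs with hu
  · rfl
  · exact h _ (F.before_first_of_mem_edge u.2 hu)

/-- `H_i` at a point of `Wⁿ` whose coordinates are read off at the least vertices. -/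
theorem localFun_first (i : Fin m) (a : F.DVertex → W) :
    localFun H (F.order i) (fun u => a (F.first u)) =
      F.sharpFun H i a (a (F.first (F.pivot i))) := by
  rw [sharpFun_apply, localFun]
  congr 2
  ext u
  split_ifs with hu
  · rw [hu]
  · rfl

/-- One step of the recursion: the `t`-th new vertex gets its transfer value. -/
noncomputable def step (t : ℕ) (a : F.DVertex → W) : F.DVertex → W :=
  if h : t < m then
    Function.update a (Sum.inr ⟨t, h⟩) (sharp.symm (F.sharpFun H ⟨t, h⟩ a))
  else a

/-- The steps `t, …, t + l - 1` of the recursion, started from arbitrary values `a`. -/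
noncomputable def run : ℕ → ℕ → (F.DVertex → W) → F.DVertex → W
  | _, 0, a => a
  | t, l + 1, a => run (t + 1) l (F.step sharp H t a)

theorem run_transferStage (v : F.Foundation → W) (t l : ℕ) :
    F.run sharp H t l (F.transferStage sharp H v t) = F.transferStage sharp H v (t + l) := by
  induction l generalizing t with
  | zero => rfl
  | succ l ih =>
    have : F.step sharp H t (F.transferStage sharp H v t) = F.transferStage sharp H v (t + 1) := by
      rw [step, transferStage]
    rw [run, this, ih]
    congr 1
    omega

/-- The qualifier with index `s` as a function of the values at all vertices of the decoupled
hypergraph. -/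
noncomputable def pairing (s : Fin m) (a : F.DVertex → W) : K :=
  sharp (a (Sum.inr s)) (a (F.first (F.p (Sum.inr s))))

theorem qualifier_eq_pairing_run (s : Fin m) (v : F.Foundation → W) :
    F.qualifier sharp H s v = F.pairing sharp s (F.run sharp H 0 m (Sum.elim v 0)) := by
  have := F.run_transferStage sharp H v 0 m
  rw [transferStage, zero_add] at this
  rw [this]
  rfl

/-- If all transfer values are prescribed consistently with the recursion, these are the values of
the transfer functions. -/
theorem transfer_eq_of_forall (a : F.DVertex → W)
    (h : ∀ i, sharp (a (Sum.inr i)) = F.sharpFun H i a) (j : F.DVertex) :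
    F.transfer sharp H j (fun u => a (Sum.inl u)) = a j := by
  have key : ∀ t ≤ m, ∀ j, F.Before t j →
      F.transferStage sharp H (fun u => a (Sum.inl u)) t j = a j := by
    intro t
    induction t with
    | zero =>
      rintro - (u | i) hj
      · rfl
      · exact absurd (hj i rfl) (by omega)
    | succ t ih =>
      intro ht j hj
      rw [transferStage, dif_pos (show t < m by omega)]
      by_cases hjt : j = Sum.inr ⟨t, by omega⟩
      · subst hjt
        rw [Function.update_self, F.sharpFun_congr H (ih (by omega)), ← h,
          LinearEquiv.symm_apply_apply]
      · rw [Function.update_of_ne hjt]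
        refine ih (by omega) j fun i hi => lt_of_le_of_ne (Nat.lt_succ_iff.mp (hj i hi)) ?_
        rintro rfl
        exact hjt hi
  exact key m le_rfl j fun i _ => i.2

end TransferFiltration

/-! ### Homogeneity -/

/-- The value at `c` of the monomial with exponents `e`. -/
def monomialEval {ι : Type*} [Fintype ι] (c : ι → K) (e : ι → ℕ) : K := ∏ x, c x ^ e x

section Monomial

variable {ι : Type*} [Fintype ι] (c : ι → K)

@[simp]
theorem monomialEval_zero : monomialEval c 0 = 1 := by simp [monomialEval]

theorem monomialEval_add (e e' : ι → ℕ) :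
    monomialEval c (e + e') = monomialEval c e * monomialEval c e' := by
  simp [monomialEval, pow_add, Finset.prod_mul_distrib]

theorem monomialEval_sum {κ : Type*} (s : Finset κ) (e : κ → ι → ℕ) :
    monomialEval c (∑ x ∈ s, e x) = ∏ x ∈ s, monomialEval c (e x) := by
  classical
  induction s using Finset.induction_on with
  | empty => simp
  | insert x s hx ih => rw [Finset.sum_insert hx, Finset.prod_insert hx, monomialEval_add, ih]

@[simp]
theorem monomialEval_single [DecidableEq ι] (x : ι) : monomialEval c (Pi.single x 1) = c x := by
  simp only [monomialEval, Pi.single_apply]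
  simp [pow_ite]

end Monomial

namespace TransferFiltration

variable (F : TransferFiltration G b) (sharp : W ≃ₗ[K] Module.Dual K W)
  {ι : Type*} [Fintype ι]

/-- If the functionals and the initial values are scaled by monomials in parameters `c`, the
results of the recursion are scaled by monomials in `c`, too. -/
theorem exists_run_smul (e : Fin m → ι → ℕ) (t l : ℕ) (d : F.DVertex → ι → ℕ) :
    ∃ d' : F.DVertex → ι → ℕ, ∀ (c : ι → K) (H : Constraint K W G) (a : F.DVertex → W),
      F.run sharp (fun i => monomialEval c (e i) • H i) t l
        (fun j => monomialEval c (d j) • a j) =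
      fun j => monomialEval c (d' j) • F.run sharp H t l a j := by
  classical
  induction l generalizing t d with
  | zero => exact ⟨d, fun _ _ _ => rfl⟩
  | succ l ih =>
    by_cases ht : t < m
    · set f : ι → ℕ := e (F.order ⟨t, ht⟩) + ∑ u : {u // u ∈ F.E ⟨t, ht⟩},
        (if (u : Fin n) = F.pivot ⟨t, ht⟩ then 0 else d (F.first u)) with hf
      have hsharp : ∀ (c : ι → K) (H : Constraint K W G) (a : F.DVertex → W),
          F.sharpFun (fun i => monomialEval c (e i) • H i) ⟨t, ht⟩
            (fun j => monomialEval c (d j) • a j) =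
          monomialEval c f • F.sharpFun H ⟨t, ht⟩ a := by
        intro c H a
        ext x
        rw [LinearMap.smul_apply, sharpFun_apply, sharpFun_apply, LinearMap.smul_apply, hf,
          monomialEval_add, monomialEval_sum, mul_smul]
        congr 1
        rw [← map_smul, ← MultilinearMap.map_smul_univ]
        congr 2
        ext u
        split_ifs <;> simp
      obtain ⟨d', hd'⟩ := ih (t + 1) (Function.update d (Sum.inr ⟨t, ht⟩) f)
      refine ⟨d', fun c H a => ?_⟩
      rw [run, run, ← hd', step, step, dif_pos ht, dif_pos ht, hsharp]
      congr 1
      ext j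
      by_cases hj : j = Sum.inr ⟨t, ht⟩
      · subst hj; simp
      · simp [Function.update_of_ne hj]
    · obtain ⟨d', hd'⟩ := ih (t + 1) d
      refine ⟨d', fun c H a => ?_⟩
      rw [run, run, ← hd', step, step, dif_neg ht, dif_neg ht]

theorem exists_pairing_run_smul (s : Fin m) (e : Fin m → ι → ℕ) (t l : ℕ)
    (d : F.DVertex → ι → ℕ) :
    ∃ f : ι → ℕ, ∀ (c : ι → K) (H : Constraint K W G) (a : F.DVertex → W),
      F.pairing sharp s (F.run sharp (fun i => monomialEval c (e i) • H i) t l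
        (fun j => monomialEval c (d j) • a j)) =
      monomialEval c f * F.pairing sharp s (F.run sharp H t l a) := by
  obtain ⟨d', hd'⟩ := F.exists_run_smul sharp e t l d
  refine ⟨d' (Sum.inr s) + d' (F.first (F.p (Sum.inr s))), fun c H a => ?_⟩
  rw [hd', monomialEval_add]
  simp only [pairing, map_smul, LinearMap.smul_apply, smul_eq_mul]
  ring

/-- The qualifier is multihomogeneous in the constraint. -/
theorem hasMultidegree_qualifier (s : Fin m) (v : F.Foundation → W) :
    ∃ d : Fin m → ℕ, HasMultidegree (fun H : Constraint K W G => F.qualifier sharp H s v) d := by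
  classical
  obtain ⟨d, hd⟩ := F.exists_pairing_run_smul sharp s (fun i => Pi.single i 1) 0 m 0
  refine ⟨d, fun c H => ?_⟩
  have := hd c H (Sum.elim v 0)
  simp only [monomialEval_single, Pi.zero_apply, monomialEval_zero, one_smul] at this
  simp only [qualifier_eq_pairing_run]
  exact this

/-- The qualifier is multihomogeneous in the vectors of the foundation. -/
theorem exists_qualifier_smul (H : Constraint K W G) (s : Fin m) :
    ∃ d : F.Foundation → ℕ, ∀ (c : F.Foundation → K) (v : F.Foundation → W),
      F.qualifier sharp H s (fun u => c u • v u) =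
        (∏ u, c u ^ d u) * F.qualifier sharp H s v := by
  classical
  obtain ⟨d, hd⟩ := F.exists_pairing_run_smul sharp s (fun _ => 0) 0 m
    (Sum.elim (fun u => Pi.single u 1) 0)
  refine ⟨d, fun c v => ?_⟩
  have := hd c H (Sum.elim v 0)
  simp only [monomialEval_zero, one_smul] at this
  rw [qualifier_eq_pairing_run, qualifier_eq_pairing_run]
  rw [monomialEval] at this
  rw [← this]
  congr 2
  ext (u | i) <;> simp

/-- The outcome of the recursion after stage `t` is homogeneous in the `t`-th new value. -/
theorem exists_pairing_run_update_smul (H : Constraint K W G) (s : Fin m) (t l : ℕ)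
    (j : F.DVertex) :
    ∃ d : ℕ, ∀ (c : K) (a : F.DVertex → W) (x : W),
      F.pairing sharp s (F.run sharp H t l (Function.update a j (c • x))) =
        c ^ d * F.pairing sharp s (F.run sharp H t l (Function.update a j x)) := by
  classical
  obtain ⟨d, hd⟩ := F.exists_pairing_run_smul sharp s (ι := Unit) (fun _ => 0) t l
    (Pi.single j (Pi.single () 1))
  refine ⟨d (), fun c a x => ?_⟩
  have := hd (fun _ => c) H (Function.update a j x)
  simp only [monomialEval_zero, one_smul] at this
  rw [show monomialEval (fun _ : Unit => c) d = c ^ d () by simp [monomialEval]] at this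
  rw [← this]
  congr 2
  ext i
  by_cases hi : i = j
  · subst hi; simp
  · simp [hi]

end TransferFiltration

/-! ### Polynomiality -/

/-- A multilinear form in vectors whose coordinates lie in a subalgebra of functions, with
coefficients in that subalgebra, lies in the subalgebra. -/
theorem dual_tprod_mem {X ι : Type*} [Finite ι] [Module.Finite K W] (A : Subalgebra K (X → K))
    {h : X → Module.Dual K (⨂[K] _ : ι, W)} (hh : ∀ τ, (fun x => h x τ) ∈ A)
    {a : X → ι → W} (ha : ∀ i (φ : Module.Dual K W), (fun x => φ (a x i)) ∈ A) :
    (fun x => h x (PiTensorProduct.tprod K (a x))) ∈ A := by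
  classical
  have := Fintype.ofFinite ι
  let B := Module.finBasis K W
  have key : ∀ x, h x (PiTensorProduct.tprod K (a x)) =
      ∑ f : ι → Fin (Module.finrank K W),
        (∏ i, B.coord (f i) (a x i)) * h x (PiTensorProduct.tprod K fun i => B (f i)) := by
    intro x
    conv_lhs => rw [show a x = fun i => ∑ l, B.coord l (a x i) • B l from
      funext fun i => (B.sum_repr (a x i)).symm]
    rw [MultilinearMap.map_sum, map_sum]
    refine Finset.sum_congr rfl fun f _ => ?_
    rw [MultilinearMap.map_smul_univ, map_smul, smul_eq_mul]
  have : (fun x => h x (PiTensorProduct.tprod K (a x))) =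
      ∑ f : ι → Fin (Module.finrank K W),
        (∏ i, fun x => B.coord (f i) (a x i)) *
          fun x => h x (PiTensorProduct.tprod K fun i => B (f i)) := by
    ext x
    rw [key]
    simp
  rw [this]
  exact sum_mem fun f _ => mul_mem (prod_mem fun i _ => ha _ _) (hh _)

namespace TransferFiltration

variable [Module.Finite K W] (F : TransferFiltration G b) (sharp : W ≃ₗ[K] Module.Dual K W)
  {X : Type*} (A : Subalgebra K (X → K))

theorem run_mem {H : X → Constraint K W G} (hH : ∀ i τ, (fun x => H x i τ) ∈ A) (t l : ℕ)
    {a : X → F.DVertex → W} (ha : ∀ j (φ : Module.Dual K W), (fun x => φ (a x j)) ∈ A)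
    (j : F.DVertex) (φ : Module.Dual K W) :
    (fun x => φ (F.run sharp (H x) t l (a x) j)) ∈ A := by
  induction l generalizing t a with
  | zero => exact ha j φ
  | succ l ih =>
    simp only [run]
    refine ih (t + 1) fun j φ => ?_
    by_cases ht : t < m
    · simp only [step, dif_pos ht]
      by_cases hj : j = Sum.inr ⟨t, ht⟩
      · subst hj
        obtain ⟨w, hw⟩ := (Module.evalEquiv K W).surjective (φ ∘ₗ sharp.symm.toLinearMap)
        have : ∀ ψ, φ (sharp.symm ψ) = ψ w := fun ψ => by
          simpa using (LinearMap.congr_fun hw ψ).symm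
        simp only [Function.update_self, this, sharpFun_apply]
        refine dual_tprod_mem A (hH _) fun u ψ => ?_
        split_ifs
        · exact A.algebraMap_mem (ψ w)
        · exact ha _ _
      · simp only [Function.update_of_ne hj]
        exact ha j φ
    · simp only [step, dif_neg ht]
      exact ha j φ

theorem pairing_run_mem {H : X → Constraint K W G} (hH : ∀ i τ, (fun x => H x i τ) ∈ A)
    (s : Fin m) (t l : ℕ) {a : X → F.DVertex → W}
    (ha : ∀ j (φ : Module.Dual K W), (fun x => φ (a x j)) ∈ A) :
    (fun x => F.pairing sharp s (F.run sharp (H x) t l (a x))) ∈ A := by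
  let B := Module.finBasis K W
  have : (fun x => F.pairing sharp s (F.run sharp (H x) t l (a x))) =
      ∑ i, (fun x => B.coord i (F.run sharp (H x) t l (a x) (F.first (F.p (Sum.inr s))))) *
        fun x => (LinearMap.applyₗ (B i) ∘ₗ sharp.toLinearMap)
          (F.run sharp (H x) t l (a x) (Sum.inr s)) := by
    ext x
    rw [pairing]
    conv_lhs => rw [← B.sum_repr (F.run sharp (H x) t l (a x) (F.first (F.p (Sum.inr s)))), map_sum]
    simp
  rw [this]
  exact sum_mem fun i _ =>
    mul_mem (F.run_mem sharp A hH t l ha _ _) (F.run_mem sharp A hH t l ha _ _)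

/-- The qualifier is a polynomial function of the constraint. -/
theorem isPolynomialFun_qualifier (s : Fin m) (v : F.Foundation → W) :
    IsPolynomialFun fun H : Constraint K W G => F.qualifier sharp H s v := by
  simp only [qualifier_eq_pairing_run]
  refine F.pairing_run_mem sharp _ (H := fun H => H) (fun i τ => ?_) s 0 m
    fun j φ => Subalgebra.algebraMap_mem _ (φ _)
  exact Algebra.subset_adjoin ⟨LinearMap.applyₗ τ ∘ₗ LinearMap.proj i, rfl⟩

/-- The outcome of the recursion is a univariate polynomial on each line in one argument. -/
theorem exists_polynomial_pairing_run (H : Constraint K W G) (s : Fin m) (t l : ℕ)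
    (a : F.DVertex → W) (j : F.DVertex) (w w' : W) :
    ∃ P : K[X], ∀ z : K, P.eval z =
      F.pairing sharp s (F.run sharp H t l (Function.update a j (w + z • w'))) := by
  let ev : K[X] →ₐ[K] (K → K) := AlgHom.pi fun z => Polynomial.aeval z
  have h := F.pairing_run_mem sharp ev.range (H := fun _ => H)
    (fun i τ => Subalgebra.algebraMap_mem _ (H i τ)) s t l
    (a := fun z => Function.update a j (w + z • w')) (fun i φ => by
      by_cases hi : i = j
      · subst hi
        refine ⟨Polynomial.C (φ w) + Polynomial.X * Polynomial.C (φ w'), ?_⟩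
        ext z
        simp [ev, mul_comm (φ w')]
      · simp only [Function.update_of_ne hi]
        exact Subalgebra.algebraMap_mem _ (φ (a i)))
  obtain ⟨P, hP⟩ := h
  exact ⟨P, fun z => by simpa [ev, Polynomial.coe_aeval_eq_eval] using congrFun hP z⟩

theorem exists_polynomial_qualifier (H : Constraint K W G) (s : Fin m) (v : F.Foundation → W)
    (j : F.Foundation) (w w' : W) :
    ∃ P : K[X], ∀ z : K, P.eval z =
      F.qualifier sharp H s (Function.update v j (w + z • w')) := by
  obtain ⟨P, hP⟩ := F.exists_polynomial_pairing_run sharp H s 0 m (Sum.elim v 0) (Sum.inl j) w w'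
  exact ⟨P, fun z => by rw [hP, qualifier_eq_pairing_run, Sum.elim_update_left]⟩

end TransferFiltration

end Run

/-! ### Extending zeros of the qualifier to product solutions -/

section Extension

variable {K W : Type*} [Field K] [AddCommGroup W] [Module K W] {n m b : ℕ}
  {G : Hypergraph n m}

/-- Over an algebraically closed field, a binary form that vanishes at the origin has a nontrivial
zero. -/
theorem exists_ne_zero_eq_zero_of_homogeneous [IsAlgClosed K] (hW : Module.finrank K W = 2)
    (f : W → K) (d : ℕ) (hd : ∀ (c : K) x, f (c • x) = c ^ d * f x)
    (hf : ∀ w w', ∃ P : K[X], ∀ z, P.eval z = f (w + z • w')) (h0 : f 0 = 0) :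
    ∃ w, w ≠ 0 ∧ f w = 0 := by
  have : Module.Finite K W := Module.finite_of_finrank_pos (by omega)
  by_contra! hne
  let B := Module.finBasisOfFinrankEq K W hW
  have hB : ∀ z : K, B 0 + z • B 1 ≠ 0 := fun z h => by
    have := congrArg (B.coord 0) h
    simp at this
  obtain ⟨P, hP⟩ := hf (B 0) (B 1)
  obtain ⟨Q, hQ⟩ := hf (B 1) (B 0)
  -- on the affine line through `B 0`, the form has no zero and is hence constant
  have hdeg : P.degree = 0 := by
    by_contra hdeg
    obtain ⟨z, hz⟩ := IsAlgClosed.exists_root P hdeg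
    exact hne _ (hB z) (by rw [← hP]; exact hz)
  rw [Polynomial.eq_C_of_degree_eq_zero hdeg] at hP
  set c := P.coeff 0
  simp only [Polynomial.eval_C] at hP
  have hd0 : d ≠ 0 := by
    rintro rfl
    refine hne (B 0) (B.ne_zero 0) ?_
    have := hd 0 (B 0)
    rwa [zero_smul, h0, pow_zero, one_mul, eq_comm] at this
  -- so on the other affine line it is `c * z ^ d`, which vanishes at the point at infinity
  have hQX : Polynomial.X * Q = Polynomial.X * (Polynomial.C c * Polynomial.X ^ d) := by
    refine Polynomial.funext fun z => ?_
    by_cases hz : z = 0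
    · simp [hz]
    · have := hd z (B 0 + z⁻¹ • B 1)
      rw [← hP, smul_add, smul_smul, mul_inv_cancel₀ hz, one_smul, add_comm, ← hQ] at this
      simp only [Polynomial.eval_mul, Polynomial.eval_X, Polynomial.eval_C, Polynomial.eval_pow,
        this]
      ring
  rw [mul_right_inj' Polynomial.X_ne_zero] at hQX
  refine hne (B 1) (B.ne_zero 1) ?_
  have := hQ 0
  rw [hQX] at this
  simpa [hd0] using this.symm

namespace TransferFiltration

variable (F : TransferFiltration G b) (sharp : W ≃ₗ[K] Module.Dual K W) (H : Constraint K W G)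

theorem first_ne_of_isQualifierIndex {s : Fin m} (hs : F.IsQualifierIndex s) (u : Fin n) :
    F.first u ≠ Sum.inr s := by
  intro h
  apply hs
  rw [← h, p_first]

/-- A zero of the only qualifier extends to a product solution. If a transfer value vanishes, its
edge is satisfied whatever the vector of its new vertex is; this vector is then taken to be a
nontrivial zero of the rest of the recursion, which is a binary form in it. -/
theorem exists_mem_productSat_of_qualifier_eq_zero [IsAlgClosed K]
    (hW : Module.finrank K W = 2) (hsharp : ∀ v : W, sharp v v = 0) {s : Fin m}
    (hs : ∀ i, F.IsQualifierIndex i ↔ i = s) (v : F.Foundation → W) (hv : ∀ u, v u ≠ 0)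
    (hq : F.qualifier sharp H s v = 0) : ∃ x ∈ productSat H, F.proj x = v := by
  have : Module.Finite K W := Module.finite_of_finrank_pos (by omega)
  have key : ∀ t l, t + l = m → ∃ a : F.DVertex → W, (∀ u, a (Sum.inl u) = v u) ∧
      (∀ i : Fin m, (i : ℕ) < t → i ≠ s → a (Sum.inr i) ≠ 0) ∧
      (∀ i : Fin m, (i : ℕ) < t → sharp (a (Sum.inr i)) = F.sharpFun H i a ∨
        F.sharpFun H i a = 0 ∧ i ≠ s) ∧
      F.pairing sharp s (F.run sharp H t l a) = 0 := by
    intro t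
    induction t with
    | zero =>
      intro l hl
      obtain rfl : l = m := by omega
      rw [qualifier_eq_pairing_run] at hq
      exact ⟨Sum.elim v 0, fun u => rfl, fun i hi => absurd hi (by omega),
        fun i hi => absurd hi (by omega), hq⟩
    | succ t ih =>
      intro l hl
      obtain ⟨a, hfound, hne, hrel, hzero⟩ := ih (l + 1) (by omega)
      have ht : t < m := by omega
      set T : Fin m := ⟨t, ht⟩
      rw [run, step, dif_pos ht] at hzero
      have hupd : ∀ (x : W) (i : Fin m), (i : ℕ) ≤ t →
          F.sharpFun H i (Function.update a (Sum.inr T) x) = F.sharpFun H i a := by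
        intro x i hi
        refine F.sharpFun_congr H fun j hj => Function.update_of_ne ?_ _ _
        rintro rfl
        exact absurd (hj T rfl) (not_lt.mpr hi)
      -- it suffices to find a suitable vector for the `t`-th new vertex
      suffices h : ∃ x : W, (T ≠ s → x ≠ 0) ∧
          (sharp x = F.sharpFun H T a ∨ F.sharpFun H T a = 0 ∧ T ≠ s) ∧
          F.pairing sharp s (F.run sharp H (t + 1) l (Function.update a (Sum.inr T) x)) = 0 by
        obtain ⟨x, hx, hxrel, hx0⟩ := h
        refine ⟨Function.update a (Sum.inr T) x, fun u => ?_, fun i hi his => ?_,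
          fun i hi => ?_, hx0⟩
        · rw [Function.update_of_ne (by simp), hfound]
        · by_cases hiT : i = T
          · subst hiT
            rw [Function.update_self]
            exact hx his
          · rw [Function.update_of_ne (by simpa using hiT)]
            exact hne i (lt_of_le_of_ne (Nat.lt_succ_iff.mp hi)
              fun h => hiT (Fin.ext h)) his
        · rw [hupd x i (Nat.lt_succ_iff.mp hi)]
          by_cases hiT : i = T
          · subst hiT
            rw [Function.update_self]
            exact hxrel
          · rw [Function.update_of_ne (by simpa using hiT)]
            exact hrel i (lt_of_le_of_ne (Nat.lt_succ_iff.mp hi) fun h => hiT (Fin.ext h))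
      by_cases hg : F.sharpFun H T a = 0 ∧ T ≠ s
      · obtain ⟨d, hd⟩ := F.exists_pairing_run_update_smul sharp H s (t + 1) l (Sum.inr T)
        obtain ⟨x, hx, hx0⟩ := exists_ne_zero_eq_zero_of_homogeneous hW
          (fun x => F.pairing sharp s
            (F.run sharp H (t + 1) l (Function.update a (Sum.inr T) x))) d (fun c x => hd c a x)
          (F.exists_polynomial_pairing_run sharp H s (t + 1) l a (Sum.inr T))
          (by rwa [hg.1, map_zero] at hzero)
        exact ⟨x, fun _ => hx, Or.inr hg, hx0⟩
      · refine ⟨_, fun hT h => hg ⟨?_, hT⟩, Or.inl (LinearEquiv.apply_symm_apply _ _), hzero⟩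
        simpa using h
  obtain ⟨a, hfound, hne, hrel, hzero⟩ := key m 0 (by omega)
  refine ⟨fun u => a (F.first u), ⟨fun u => ?_, fun i => ?_⟩, ?_⟩
  · have hu := F.first_ne_of_isQualifierIndex ((hs s).mpr rfl) u
    dsimp only
    rcases hj : F.first u with j | i
    · rw [hfound]
      exact hv j
    · exact hne i i.2 fun h => hu (by rw [hj, h])
  · obtain ⟨i, rfl⟩ := F.order.surjective i
    rw [localFun_first]
    rcases hrel i i.2 with h | ⟨h, -⟩
    · rw [← h]
      by_cases his : i = s
      · subst his
        exact hzero
      · have : F.first (F.p (Sum.inr i)) = Sum.inr i := by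
          by_contra hi
          exact his ((hs i).mp hi)
        rw [show F.pivot i = F.p (Sum.inr i) from rfl, this]
        exact hsharp _
    · rw [h, LinearMap.zero_apply]
  · ext u
    simp only [proj, blowUp, first_p_inl, hfound]

/-! ### Constraints with a nonvanishing qualifier -/

/-- Each edge has a vertex other than its new one, so the transfer functions vanish at the
origin. -/
theorem qualifier_zero {k : ℕ} (hk : 2 ≤ k) (hG : G.IsUniform k) (s : Fin m) :
    F.qualifier sharp H s 0 = 0 := by
  have h : ∀ i, F.sharpFun H i 0 = 0 := by
    intro i
    obtain ⟨u, hu, hne⟩ := Finset.exists_mem_ne (s := F.E i) (by rw [hG]; omega) (F.pivot i)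
    ext x
    rw [sharpFun_apply,
      MultilinearMap.map_coord_zero _ (⟨u, hu⟩ : {u // u ∈ F.E i}) (by simp [hne])]
    simp
  have h0 := F.transfer_eq_of_forall sharp H 0 (fun i => by rw [h]; simp)
  simp only [Pi.zero_apply] at h0
  rw [qualifier]
  change sharp (F.transfer sharp H _ 0) (F.transfer sharp H _ 0) = 0
  rw [show (0 : F.Foundation → W) = fun _ => 0 from rfl, h0, map_zero, LinearMap.zero_apply]

/-- Suitable decomposable functionals make all transfer values at the constant point `e` equal to
`e`, except for the one that the qualifier compares with `e`. -/
theorem exists_qualifier_ne_zero {s : Fin m} (hs : F.IsQualifierIndex s) {e : W} (he : e ≠ 0) :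
    ∃ H : Constraint K W G, F.qualifier sharp H s (fun _ => e) ≠ 0 := by
  classical
  obtain ⟨φ, hφ⟩ := Module.Projective.exists_dual_eq_one K he
  let a : F.DVertex → W := Function.update (fun _ => e) (Sum.inr s) (sharp.symm φ)
  have ha : ∀ u, a (F.first u) = e := fun u =>
    Function.update_of_ne (F.first_ne_of_isQualifierIndex hs u) _ _
  let H : Constraint K W G := fun j => PiTensorProduct.lift
    ((MultilinearMap.mkPiAlgebra K {u // u ∈ G.edge j} K).compLinearMap fun u =>
      if (u : Fin n) = F.pivot (F.order.symm j) then sharp (a (Sum.inr (F.order.symm j))) else φ)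
  have hH : ∀ i, sharp (a (Sum.inr i)) = F.sharpFun H i a := by
    intro i
    ext x
    rw [sharpFun_apply, PiTensorProduct.lift.tprod, MultilinearMap.compLinearMap_apply,
      MultilinearMap.mkPiAlgebra_apply, Finset.prod_eq_single
        (⟨F.pivot i, F.pivot_mem i⟩ : {u // u ∈ F.E i})]
    · simp
    · intro u _ hu
      have : (u : Fin n) ≠ F.pivot i := fun h => hu (Subtype.ext h)
      simp [this, ha, hφ]
    · simp
  have hT := F.transfer_eq_of_forall sharp H a hH
  have hfound : (fun u : F.Foundation => a (Sum.inl u)) = fun _ => e := by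
    ext u
    exact Function.update_of_ne (by simp) _ _
  rw [hfound] at hT
  refine ⟨H, ?_⟩
  rw [qualifier, hT, hT, ha]
  simp [a, hφ]

/-- Where the qualifier does not vanish, it has positive degree in some argument, since it vanishes
at the origin. It hence has a zero on the axis of this argument, and the line to that zero is one
on which it is not constant. -/
theorem exists_line [IsAlgClosed K] (hW : Module.finrank K W = 2) {k : ℕ} (hk : 2 ≤ k)
    (hG : G.IsUniform k) (s : Fin m) (v : F.Foundation → W) (hv : ∀ u, v u ≠ 0)
    (hq : F.qualifier sharp H s v ≠ 0) :
    ∃ (j : F.Foundation) (w' : W), LinearIndependent K ![v j, w'] ∧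
      F.qualifier sharp H s (Function.update v j (v j + w')) = 0 := by
  classical
  have : Module.Finite K W := Module.finite_of_finrank_pos (by omega)
  obtain ⟨d, hd⟩ := F.exists_qualifier_smul sharp H s
  obtain ⟨j, hj⟩ : ∃ j, d j ≠ 0 := by
    by_contra! h
    have h0 := hd 0 v
    rw [show (fun u => (0 : F.Foundation → K) u • v u) = 0 by ext; simp,
      F.qualifier_zero sharp H hk hG] at h0
    exact hq (by simpa [h] using h0.symm)
  have hhom : ∀ (c : K) (x : W), F.qualifier sharp H s (Function.update v j (c • x)) =
      c ^ d j * F.qualifier sharp H s (Function.update v j x) := by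
    intro c x
    have h := hd (Function.update 1 j c) (Function.update v j x)
    rw [Finset.prod_eq_single j (fun u _ hu => by simp [hu]) (by simp),
      Function.update_self] at h
    rw [← h]
    congr 1
    ext u
    by_cases hu : u = j
    · subst hu; simp
    · simp [hu]
  obtain ⟨w, hw, hw0⟩ := exists_ne_zero_eq_zero_of_homogeneous hW
    (fun x => F.qualifier sharp H s (Function.update v j x)) (d j) hhom
    (F.exists_polynomial_qualifier sharp H s v j) (by
      have := hhom 0 0
      rwa [zero_smul, zero_pow hj, zero_mul] at this)
  refine ⟨j, w - v j, ?_, by rwa [add_sub_cancel]⟩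
  rw [LinearIndependent.pair_iff' (hv j)]
  intro c hc
  obtain rfl : (c + 1) • v j = w := by rw [add_smul, hc, one_smul, sub_add_cancel]
  rw [hhom, Function.update_eq_self, mul_eq_zero, or_iff_left hq] at hw0
  exact hw (by rw [pow_eq_zero_iff hj |>.mp hw0, zero_smul])

end TransferFiltration

end Extension

/-! ### Polynomial functions on a vector space -/

section PolynomialFun

variable {K : Type*} [Field K] {X : Type*} [AddCommGroup X] [Module K X]

theorem IsPolynomialFun.exists_polynomial {f : X → K} (hf : IsPolynomialFun f) (x y : X) :
    ∃ P : K[X], ∀ t : K, P.eval t = f (x + t • y) := by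
  induction hf using Algebra.adjoin_induction with
  | mem f hf =>
    obtain ⟨φ, rfl⟩ := hf
    exact ⟨Polynomial.C (φ x) + Polynomial.X * Polynomial.C (φ y),
      fun t => by simp [mul_comm (φ y)]⟩
  | algebraMap r => exact ⟨Polynomial.C r, fun t => by simp⟩
  | add f g _ _ hf hg =>
    obtain ⟨P, hP⟩ := hf
    obtain ⟨Q, hQ⟩ := hg
    exact ⟨P + Q, fun t => by simp [hP, hQ]⟩
  | mul f g _ _ hf hg =>
    obtain ⟨P, hP⟩ := hf
    obtain ⟨Q, hQ⟩ := hg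
    exact ⟨P * Q, fun t => by simp [hP, hQ]⟩

/-- Finitely many nonzero polynomial functions over an infinite field are nonzero at a common
point. -/
theorem exists_forall_ne_zero_of_isPolynomialFun [Infinite K] {ι : Type*} (s : Finset ι)
    (f : ι → X → K) (hf : ∀ i ∈ s, IsPolynomialFun (f i)) (hne : ∀ i ∈ s, ∃ x, f i x ≠ 0) :
    ∃ x, ∀ i ∈ s, f i x ≠ 0 := by
  classical
  induction s using Finset.induction_on with
  | empty => exact ⟨0, by simp⟩
  | insert i s hi ih =>
    obtain ⟨x, hx⟩ := ih (fun l hl => hf l (Finset.mem_insert_of_mem hl))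
      fun l hl => hne l (Finset.mem_insert_of_mem hl)
    obtain ⟨y, hy⟩ := hne i (Finset.mem_insert_self i s)
    have hprod : IsPolynomialFun (∏ l ∈ s, f l) :=
      prod_mem fun l hl => hf l (Finset.mem_insert_of_mem hl)
    -- on the line from `x` to `y`, both factors are nonzero polynomials
    obtain ⟨P, hP⟩ := hprod.exists_polynomial x (y - x)
    obtain ⟨Q, hQ⟩ := (hf i (Finset.mem_insert_self i s)).exists_polynomial x (y - x)
    have hP0 : P ≠ 0 := by
      rintro rfl
      have := hP 0
      rw [Polynomial.eval_zero, zero_smul, add_zero, Finset.prod_apply, eq_comm,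
        Finset.prod_eq_zero_iff] at this
      obtain ⟨l, hl, hl0⟩ := this
      exact hx l hl hl0
    have hQ0 : Q ≠ 0 := by
      rintro rfl
      have := hQ 1
      rw [Polynomial.eval_zero, one_smul, add_sub_cancel] at this
      exact hy this.symm
    obtain ⟨t, ht⟩ : ∃ t, (P * Q).eval t ≠ 0 := by
      by_contra! h
      exact mul_ne_zero hP0 hQ0 (Polynomial.funext fun t => by rw [h, Polynomial.eval_zero])
    rw [Polynomial.eval_mul, hP, hQ, Finset.prod_apply, mul_ne_zero_iff,
      Finset.prod_ne_zero_iff] at ht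
    exact ⟨_, Finset.forall_mem_insert _ _ _ |>.mpr ⟨ht.2, ht.1⟩⟩

theorem HasMultidegree.prod {ι : Type*} [Fintype ι] {X : ι → Type*} [∀ i, AddCommGroup (X i)]
    [∀ i, Module K (X i)] {κ : Type*} (s : Finset κ) {f : κ → (∀ i, X i) → K} {d : κ → ι → ℕ}
    (h : ∀ l ∈ s, HasMultidegree (f l) (d l)) :
    HasMultidegree (∏ l ∈ s, f l) (∑ l ∈ s, d l) := by
  intro c x
  simp only [Finset.prod_apply, Finset.sum_apply]
  rw [Finset.prod_congr rfl fun l hl => h l hl c x, Finset.prod_mul_distrib, Finset.prod_comm]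
  simp only [Finset.prod_pow_eq_pow_sum]

/-- A multihomogeneous function vanishes at a representative of a point of a product of projective
spaces if and only if it vanishes at every representative. -/
theorem HasMultidegree.rep_mk_ne_zero_iff {ι : Type*} [Fintype ι] {X : ι → Type*}
    [∀ i, AddCommGroup (X i)] [∀ i, Module K (X i)] {f : (∀ i, X i) → K} {d : ι → ℕ}
    (h : HasMultidegree f d) (x : ∀ i, X i) (hx : ∀ i, x i ≠ 0) :
    f (fun i => (Projectivization.mk K (x i) (hx i)).rep) ≠ 0 ↔ f x ≠ 0 := by
  choose c hc using fun i => Projectivization.exists_smul_eq_mk_rep K (x i) (hx i)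
  have h' := h (fun i => (c i : K)) x
  rw [show (fun i => (c i : K) • x i) = fun i => (Projectivization.mk K (x i) (hx i)).rep from
    funext hc] at h'
  rw [h', mul_ne_zero_iff, and_iff_right_iff_imp]
  exact fun _ => Finset.prod_ne_zero_iff.mpr fun i _ => pow_ne_zero _ (c i).ne_zero

end PolynomialFun

end QSAT

/-! ### Generic constraints -/

theorem theorem1 {K : Type*} [Field K] [IsAlgClosed K]
    {W : Type*} [AddCommGroup W] [Module K W] (hW : Module.finrank K W = 2)
    (sharp : W ≃ₗ[K] Module.Dual K W) (hsharp : ∀ v : W, sharp v v = 0)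
    {k n m b : ℕ} (hk : 2 ≤ k) (hb : b + m = n + 1)
    (G : QSAT.Hypergraph n m) (hG : G.IsUniform k) :
    ∃ U : Set (∀ i : Fin m, ℙ K (Module.Dual K (⨂[K] _ : {u // u ∈ G.edge i}, W))),
      U.Nonempty ∧ QSAT.IsZariskiOpen U ∧
      ∀ (H : QSAT.Constraint K W G) (hH : ∀ i, H i ≠ 0),
        (fun i => Projectivization.mk K (H i) (hH i)) ∈ U →
        ∀ F : QSAT.TransferFiltration G b,
          -- there is exactly one qualifier
          ∃ s : Fin m, (∀ i, F.IsQualifierIndex i ↔ i = s) ∧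
            -- the zero set of its pullback meets the product satisfiability set
            (((fun v : Fin n → W => F.qualifier sharp H s (F.proj v)) ⁻¹' {0}) ∩
              QSAT.productSat H).Nonempty ∧
            -- each of its zeros is the image of a product solution
            (∀ v : F.Foundation → W, (∀ u, v u ≠ 0) → F.qualifier sharp H s v = 0 →
              ∃ x ∈ QSAT.productSat H, F.proj x = v) ∧
            -- on each line in one argument it is a univariate polynomial, every root of which
            -- extends to a product solution
            (∀ (w : F.Foundation → W) (j : F.Foundation) (w' : W), (∀ u, w u ≠ 0) →
              LinearIndependent K ![w j, w'] →
              ∃ P : K[X], (∀ t : K, P.eval t =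
                  F.qualifier sharp H s (Function.update w j (w j + t • w'))) ∧
                ∀ t : K, P.IsRoot t →
                  ∃ x ∈ QSAT.productSat H, F.proj x = Function.update w j (w j + t • w')) ∧
            -- on some such line this polynomial is not constant
            ∃ (w : F.Foundation → W) (j : F.Foundation) (w' : W) (P : K[X]), (∀ u, w u ≠ 0) ∧
              LinearIndependent K ![w j, w'] ∧ 0 < P.natDegree ∧
              ∀ t : K, P.eval t =
                F.qualifier sharp H s (Function.update w j (w j + t • w')) := by
  classical
  have : Module.Finite K W := Module.finite_of_finrank_pos (by omega)
  have : Fintype (QSAT.TransferFiltration G b) := Fintype.ofFinite _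
  have : Nontrivial W := Module.nontrivial_of_finrank_pos (R := K) (by omega)
  obtain ⟨e, he⟩ := exists_ne (0 : W)
  choose s hs using fun F : QSAT.TransferFiltration G b => F.exists_unique_isQualifierIndex hb
  choose d hd using fun F : QSAT.TransferFiltration G b =>
    F.hasMultidegree_qualifier sharp (s F) (fun _ => e)
  refine ⟨{x | ∀ F : QSAT.TransferFiltration G b,
    F.qualifier sharp (fun i => (x i).rep) (s F) (fun _ => e) ≠ 0}, ?_, ?_, ?_⟩
  · obtain ⟨φ, hφ⟩ := Module.Projective.exists_dual_eq_one K he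
    -- besides the qualifiers, a coordinate of each functional is required not to vanish
    let f : QSAT.TransferFiltration G b ⊕ Fin m → QSAT.Constraint K W G → K :=
      Sum.elim (fun F H => F.qualifier sharp H (s F) fun _ => e)
        (fun i H => H i (PiTensorProduct.tprod K fun _ => e))
    obtain ⟨H, hH⟩ := QSAT.exists_forall_ne_zero_of_isPolynomialFun Finset.univ f
      (by
        rintro (F | i) -
        · exact F.isPolynomialFun_qualifier sharp (s F) _
        · exact Algebra.subset_adjoin
            ⟨LinearMap.applyₗ (PiTensorProduct.tprod K fun _ => e) ∘ₗ LinearMap.proj i, rfl⟩)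
      (by
        rintro (F | i) -
        · exact F.exists_qualifier_ne_zero sharp ((hs F _).mpr rfl) he
        · refine ⟨fun j => PiTensorProduct.lift ((MultilinearMap.mkPiAlgebra K _ K).compLinearMap
            fun _ => φ), ?_⟩
          simp [f, hφ])
    have hH0 : ∀ i, H i ≠ 0 := fun i h => hH (Sum.inr i) (Finset.mem_univ _) (by simp [f, h])
    exact ⟨fun i => Projectivization.mk K (H i) (hH0 i), fun F =>
      ((hd F).rep_mk_ne_zero_iff H hH0).mpr (hH (Sum.inl F) (Finset.mem_univ _))⟩
  · refine ⟨{∏ F : QSAT.TransferFiltration G b,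
      fun H => F.qualifier sharp H (s F) (fun _ => e)}, ?_, ?_⟩
    · rintro _ rfl
      exact ⟨prod_mem fun F _ => F.isPolynomialFun_qualifier sharp (s F) _, _,
        QSAT.HasMultidegree.prod _ fun F _ => hd F⟩
    · ext x
      simp [Finset.prod_eq_zero_iff]
  · intro H hH hU F
    have hq : F.qualifier sharp H (s F) (fun _ => e) ≠ 0 :=
      ((hd F).rep_mk_ne_zero_iff H hH).mp (hU F)
    have hext := F.exists_mem_productSat_of_qualifier_eq_zero sharp H hW hsharp (hs F)
    obtain ⟨j, w', hli, h0⟩ := F.exists_line sharp H hW hk hG (s F) (fun _ => e) (fun _ => he) hq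
    have hline : ∀ (w : F.Foundation → W) (j : F.Foundation) (w' : W), (∀ u, w u ≠ 0) →
        LinearIndependent K ![w j, w'] →
        ∀ (t : K) (u), Function.update w j (w j + t • w') u ≠ 0 := by
      intro w j w' hw hli t u
      by_cases hu : u = j
      · subst hu
        rw [Function.update_self]
        intro h
        have := LinearIndependent.pair_iff.mp hli 1 t (by rwa [one_smul])
        exact one_ne_zero this.1
      · rw [Function.update_of_ne hu]
        exact hw u
    refine ⟨s F, hs F, ?_, hext, ?_, ?_⟩
    · obtain ⟨x, hx, hpx⟩ := hext _ (by simpa using hline _ j w' (fun _ => he) hli 1) h0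
      exact ⟨x, by simpa [hpx] using h0, hx⟩
    · intro w j w' hw hli
      obtain ⟨P, hP⟩ := F.exists_polynomial_qualifier sharp H (s F) w j (w j) w'
      exact ⟨P, hP, fun t ht => hext _ (hline w j w' hw hli t) (by rw [← hP]; exact ht)⟩
    · obtain ⟨P, hP⟩ := F.exists_polynomial_qualifier sharp H (s F) (fun _ => e) j e w'
      refine ⟨fun _ => e, j, w', P, fun _ => he, hli, ?_, hP⟩
      -- the polynomial does not vanish at `0`, but it vanishes at `1`
      have hP0 := hP 0
      have hP1 := hP 1
      rw [zero_smul, add_zero, Function.update_eq_self_iff.mpr rfl] at hP0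
      rw [one_smul, h0] at hP1
      by_contra hdeg
      rw [Polynomial.eq_C_of_natDegree_eq_zero (by omega : P.natDegree = 0),
        Polynomial.eval_C] at hP0 hP1
      exact hq (by rw [← hP0, hP1])
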